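/- Let $(M_1,g_1)$ and $(M_2,g_2)$ be smooth pseudo-Riemannian manifolds of dimensions $n_1,n_2\ge 2$, let $f\colon M_1\to(0,\infty)$ be smooth, and let $M=M_1\times_f M_2$ be the warped product, i.e. the product manifold $M_1\times M_2$ of dimension $n=n_1+n_2$ with the metric $g=\pi_1^*g_1+(f\circ\pi_1)^2\,\pi_2^*g_2$, where $\pi_1,\pi_2$ are the projections. Write $\mathcal R(X,Y)Z=\nabla_Y\nabla_XZ-\nabla_X\nabla_YZ+\nabla_{[X,Y]}Z$ for the Riemann tensor of $g$ and $\tau$ for its scalar curvature (with the sign for which round spheres have $\tau>0$). Suppose that $M$ is concircularly flat, i.e. its concircular curvature tensor $$\mathcal C(X,Y)Z=\mathcal R(X,Y)Z-\frac{\tau}{n(n-1)}\left[g(X,Z)Y-g(Y,Z)X\right]$$ vanishes identically. A smooth vector field $\zeta$ on a pseudo-Riemannian manifold is called concircular if there is a smooth function $\varphi$ with $\nabla_X\zeta=\varphi X$ for all vector fields $X$ (concurrent fields are the case $\varphi=1$). Suppose that $M_1$ admits a concircular vector field $\zeta_1$ and that one of the following holds: (1) $M_2$ admits a concircular vector field $\zeta_2$,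 and $f$ is constant; or (2) $\zeta_1(f)=f$. Then $M$ is flat, i.e. $\mathcal R=0$ on $M$. -/

import Mathlib

open scoped Manifold ContDiff

noncomputable section

namespace PseudoRiemann

/-! ### Tensor calculus in coordinates

`G` is the coordinate expression of a metric on an open subset of the coordinate space `E`:
`G x u v` is the value of the metric at `x` on the vectors `u`, `v`. -/

section Coordinates

variable {E : Type*} [NormedAddCommGroup E] [NormedSpace ℝ E]

/-- Christoffel symbols of the metric `G`: the vector `Γ(u, v)` at `x` such that
`2 G(Γ(u, v), w) = ∂_u G(v, w) + ∂_v G(u, w) - ∂_w G(u, v)` for all `w`. -/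
def christoffel (G : E → E →L[ℝ] E →L[ℝ] ℝ) (x u v : E) : E :=
  (G x).inverse ((1 / 2 : ℝ) •
    (fderiv ℝ G x u v + fderiv ℝ G x v u - ((fderiv ℝ G x).flip u).flip v))

/-- The Levi-Civita covariant derivative `∇_v Z` at `x` of the vector field `Z`. -/
def covDeriv (G : E → E →L[ℝ] E →L[ℝ] ℝ) (Z : E → E) (x v : E) : E :=
  fderiv ℝ Z x v + christoffel G x v (Z x)

/-- The Riemann tensor, with the sign convention
`R(X, Y) Z = ∇_Y ∇_X Z - ∇_X ∇_Y Z + ∇_[X, Y] Z`, evaluated on the constant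
coordinate fields `u`, `v`, `w` (whose Lie brackets vanish). -/
def riemann (G : E → E →L[ℝ] E →L[ℝ] ℝ) (x u v w : E) : E :=
  covDeriv G (fun y => covDeriv G (fun _ => w) y u) x v
    - covDeriv G (fun y => covDeriv G (fun _ => w) y v) x u

variable [FiniteDimensional ℝ E]

/-- The Ricci tensor: `Ric(u, w)` is the trace of `v ↦ R(u, v) w`
(it is positive on round spheres). -/
def ricci (G : E → E →L[ℝ] E →L[ℝ] ℝ) (x u w : E) : ℝ :=
  ∑ i, (Module.finBasis ℝ E).coord i (riemann G x u (Module.finBasis ℝ E i) w)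

/-- The entries `g^{ij}` of the inverse of the Gram matrix of the metric. -/
def inverseMetric (G : E → E →L[ℝ] E →L[ℝ] ℝ) (x : E)
    (i j : Fin (Module.finrank ℝ E)) : ℝ :=
  (Matrix.of fun k l => G x (Module.finBasis ℝ E k) (Module.finBasis ℝ E l))⁻¹ i j

/-- The scalar curvature `τ = g^{ij} R_{ij}`. -/
def scalarCurvature (G : E → E →L[ℝ] E →L[ℝ] ℝ) (x : E) : ℝ :=
  ∑ i, ∑ j, inverseMetric G x i j *
    ricci G x (Module.finBasis ℝ E i) (Module.finBasis ℝ E j)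

/-- The concircular curvature tensor
`C(u, v) w = R(u, v) w - τ / (n (n - 1)) (g(u, w) v - g(v, w) u)`, where `n = dim E`. -/
def concircularTensor (G : E → E →L[ℝ] E →L[ℝ] ℝ) (x u v w : E) : E :=
  riemann G x u v w
    - (scalarCurvature G x / ((Module.finrank ℝ E : ℝ) * ((Module.finrank ℝ E : ℝ) - 1))) •
      (G x u w • v - G x v w • u)

end Coordinates

/-! ### Pseudo-Riemannian manifolds

Manifolds without boundary modelled on a finite-dimensional space `E`. -/

section Manifold

variable {E : Type*} [NormedAddCommGroup E] [NormedSpace ℝ E]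
  {H : Type*} [TopologicalSpace H] (I : ModelWithCorners ℝ E H)
  {M : Type*} [TopologicalSpace M] [ChartedSpace H M]

/-- A pseudo-Riemannian metric: a smooth field of nondegenerate symmetric bilinear forms on
the tangent spaces. -/
structure IsPseudoRiemannianMetric [IsManifold I ∞ M]
    (g : Π p : M, TangentSpace I p →L[ℝ] TangentSpace I p →L[ℝ] ℝ) : Prop where
  symm : ∀ (p : M) (v w : TangentSpace I p), g p v w = g p w v
  nondegenerate : ∀ (p : M) (v : TangentSpace I p), (∀ w, g p v w = 0) → v = 0
  contMDiff : ContMDiff I (I.prod 𝓘(ℝ, E →L[ℝ] E →L[ℝ] ℝ)) ∞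
    (fun p => Bundle.TotalSpace.mk' (E →L[ℝ] E →L[ℝ] ℝ)
      (E := fun p : M => TangentSpace I p →L[ℝ] TangentSpace I p →L[ℝ] ℝ) p (g p))

/-- The coordinate expression of `g` in the chart `e`: its pull-back under the inverse chart. -/
def metricInChart (g : Π p : M, TangentSpace I p →L[ℝ] TangentSpace I p →L[ℝ] ℝ)
    (e : OpenPartialHomeomorph M H) (x : E) : E →L[ℝ] E →L[ℝ] ℝ :=
  letI A : E →L[ℝ] E := mfderiv 𝓘(ℝ, E) I (e.extend I).symm x
  letI B : E →L[ℝ] E →L[ℝ] ℝ := g ((e.extend I).symm x)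
  B.bilinearComp A A

/-- The coordinate expression of the vector field `ζ` in the chart `e`. -/
def fieldInChart (ζ : Π p : M, TangentSpace I p) (e : OpenPartialHomeomorph M H) : E → E :=
  VectorField.mpullback 𝓘(ℝ, E) I (e.extend I).symm ζ

/-- A concircular vector field: a smooth vector field `ζ` with `∇_X ζ = φ X` for all `X`, for
some smooth function `φ`; the equation is read in all charts of the atlas. -/
def IsConcircular [IsManifold I ∞ M]
    (g : Π p : M, TangentSpace I p →L[ℝ] TangentSpace I p →L[ℝ] ℝ)
    (ζ : Π p : M, TangentSpace I p) : Prop :=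
  ContMDiff I I.tangent ∞ (fun p => (⟨p, ζ p⟩ : TangentBundle I M)) ∧
  ∃ φ : M → ℝ, ContMDiff I 𝓘(ℝ, ℝ) ∞ φ ∧
    ∀ e ∈ atlas H M, ∀ x ∈ (e.extend I).target, ∀ v : E,
      covDeriv (metricInChart I g e) (fieldInChart I ζ e) x v = φ ((e.extend I).symm x) • v

/-- `(M, g)` is flat: its Riemann tensor vanishes at every point, in all charts of the atlas. -/
def IsFlat (g : Π p : M, TangentSpace I p →L[ℝ] TangentSpace I p →L[ℝ] ℝ) : Prop :=
  ∀ e ∈ atlas H M, ∀ x ∈ (e.extend I).target, ∀ u v w : E,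
    riemann (metricInChart I g e) x u v w = 0

/-- `(M, g)` is concircularly flat: its concircular curvature tensor vanishes at every point,
in all charts of the atlas. -/
def IsConcircularlyFlat [FiniteDimensional ℝ E]
    (g : Π p : M, TangentSpace I p →L[ℝ] TangentSpace I p →L[ℝ] ℝ) : Prop :=
  ∀ e ∈ atlas H M, ∀ x ∈ (e.extend I).target, ∀ u v w : E,
    concircularTensor (metricInChart I g e) x u v w = 0

end Manifold

/-! ### Warped products -/

section Warped

variable {E₁ : Type*} [NormedAddCommGroup E₁] [NormedSpace ℝ E₁]
  {H₁ : Type*} [TopologicalSpace H₁] (I₁ : ModelWithCorners ℝ E₁ H₁)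
  {M₁ : Type*} [TopologicalSpace M₁] [ChartedSpace H₁ M₁]
  {E₂ : Type*} [NormedAddCommGroup E₂] [NormedSpace ℝ E₂]
  {H₂ : Type*} [TopologicalSpace H₂] (I₂ : ModelWithCorners ℝ E₂ H₂)
  {M₂ : Type*} [TopologicalSpace M₂] [ChartedSpace H₂ M₂]

/-- The warped product metric `π₁^* g₁ + (f ∘ π₁)² π₂^* g₂` on `M₁ × M₂`. -/
def warpedMetric (g₁ : Π p : M₁, TangentSpace I₁ p →L[ℝ] TangentSpace I₁ p →L[ℝ] ℝ)
    (g₂ : Π q : M₂, TangentSpace I₂ q →L[ℝ] TangentSpace I₂ q →L[ℝ] ℝ) (f : M₁ → ℝ)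
    (p : M₁ × M₂) :
    TangentSpace (I₁.prod I₂) p →L[ℝ] TangentSpace (I₁.prod I₂) p →L[ℝ] ℝ :=
  letI A₁ : E₁ × E₂ →L[ℝ] E₁ := mfderiv (I₁.prod I₂) I₁ Prod.fst p
  letI A₂ : E₁ × E₂ →L[ℝ] E₂ := mfderiv (I₁.prod I₂) I₂ Prod.snd p
  letI B₁ : E₁ →L[ℝ] E₁ →L[ℝ] ℝ := g₁ p.1
  letI B₂ : E₂ →L[ℝ] E₂ →L[ℝ] ℝ := g₂ p.2
  (B₁.bilinearComp A₁ A₁ + f p.1 ^ 2 • B₂.bilinearComp A₂ A₂ :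
    E₁ × E₂ →L[ℝ] E₁ × E₂ →L[ℝ] ℝ)

end Warped

end PseudoRiemann

end

namespace PseudoRiemann
open Filter Topology

set_option synthInstance.maxHeartbeats 200000
set_option maxSynthPendingDepth 5

section Calculus

variable {E : Type*} [NormedAddCommGroup E] [NormedSpace ℝ E]

/-- `G` is a nondegenerate symmetric form of class `C²` on the open set `Ω`. -/
structure IsMetricOn (G : E → E →L[ℝ] E →L[ℝ] ℝ) (Ω : Set E) : Prop where
  isOpen : IsOpen Ω
  contDiffOn : ContDiffOn ℝ 2 G Ω
  symm : ∀ x ∈ Ω, ∀ u v, G x u v = G x v u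
  nondegenerate : ∀ x ∈ Ω, ∀ u, (∀ v, G x u v = 0) → u = 0

/-- The Christoffel symbol `Γ(u, ·)` as a linear map. -/
noncomputable def christoffelMap (G : E → E →L[ℝ] E →L[ℝ] ℝ) (x u : E) : E →L[ℝ] E :=
  (G x).inverse ∘L ((1 / 2 : ℝ) •
    (fderiv ℝ G x u + (fderiv ℝ G x).flip u - ((fderiv ℝ G x).flip u).flip))

lemma christoffelMap_apply (G : E → E →L[ℝ] E →L[ℝ] ℝ) (x u v : E) :
    christoffelMap G x u v = christoffel G x u v := rfl

lemma covDeriv_const (G : E → E →L[ℝ] E →L[ℝ] ℝ) (w x v : E) :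
    covDeriv G (fun _ => w) x v = christoffel G x v w := by
  simp [covDeriv]

lemma riemann_eq_christoffel (G : E → E →L[ℝ] E →L[ℝ] ℝ) (x u v w : E) :
    riemann G x u v w =
      fderiv ℝ (fun y => christoffel G y u w) x v + christoffel G x v (christoffel G x u w)
        - (fderiv ℝ (fun y => christoffel G y v w) x u
          + christoffel G x u (christoffel G x v w)) := by
  simp only [riemann, covDeriv_const]
  rfl

lemma differentiableAt_clm_of_apply [FiniteDimensional ℝ E] {F : Type*} [NormedAddCommGroup F]
    [NormedSpace ℝ F] {A : E → E →L[ℝ] F} {x : E}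
    (h : ∀ u, DifferentiableAt ℝ (fun y => A y u) x) : DifferentiableAt ℝ A x := by
  let b := Module.finBasis ℝ E
  have hA : A = fun y => ∑ i, ContinuousLinearMap.smulRightL ℝ E F
      (LinearMap.toContinuousLinearMap (b.coord i)) (A y (b i)) := by
    funext y
    ext u
    conv_lhs => rw [← b.sum_repr u, map_sum]
    simp
  rw [hA]
  exact DifferentiableAt.fun_sum fun i _ =>
    (ContinuousLinearMap.differentiableAt _).comp x (h (b i))

/-- A linear form on a space of dimension at least two has a nonzero vector in its kernel. -/
lemma exists_ne_zero_apply_eq_zero [FiniteDimensional ℝ E] (h2 : 2 ≤ Module.finrank ℝ E) (l : E →L[ℝ] ℝ) :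
    ∃ u, u ≠ 0 ∧ l u = 0 := by
  have h := LinearMap.finrank_range_add_finrank_ker l.toLinearMap
  have h1 : Module.finrank ℝ (LinearMap.range l.toLinearMap) ≤ 1 := by
    simpa using Submodule.finrank_le (LinearMap.range l.toLinearMap)
  have : 0 < Module.finrank ℝ (LinearMap.ker l.toLinearMap) := by omega
  have := Module.finrank_pos_iff.1 this
  obtain ⟨⟨u, hu⟩, hne⟩ := exists_ne (0 : LinearMap.ker l.toLinearMap)
  exact ⟨u, fun h => hne (Subtype.ext h), hu⟩

namespace IsMetricOn

variable {G : E → E →L[ℝ] E →L[ℝ] ℝ} {Ω : Set E}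

lemma mem_nhds (hG : IsMetricOn G Ω) {x : E} (hx : x ∈ Ω) : Ω ∈ 𝓝 x :=
  hG.isOpen.mem_nhds hx

lemma contDiffAt (hG : IsMetricOn G Ω) {x : E} (hx : x ∈ Ω) : ContDiffAt ℝ 2 G x :=
  hG.contDiffOn.contDiffAt (hG.mem_nhds hx)

lemma differentiableAt (hG : IsMetricOn G Ω) {x : E} (hx : x ∈ Ω) : DifferentiableAt ℝ G x :=
  (hG.contDiffAt hx).differentiableAt (by norm_num)

lemma differentiableAt_fderiv (hG : IsMetricOn G Ω) {x : E} (hx : x ∈ Ω) :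
    DifferentiableAt ℝ (fderiv ℝ G) x :=
  ((hG.contDiffAt hx).fderiv_right (m := 1) (by norm_num)).differentiableAt (by norm_num)

lemma fderiv_apply_apply (hG : IsMetricOn G Ω) {x : E} (hx : x ∈ Ω) (u v a : E) :
    fderiv ℝ (fun y => G y u v) x a = fderiv ℝ G x a u v := by
  have h := (hG.differentiableAt hx).hasFDerivAt
  have h2 := (h.clm_apply (hasFDerivAt_const u x)).clm_apply (hasFDerivAt_const v x)
  rw [h2.fderiv]
  simp

lemma fderiv_symm (hG : IsMetricOn G Ω) {x : E} (hx : x ∈ Ω) (a u v : E) :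
    fderiv ℝ G x a u v = fderiv ℝ G x a v u := by
  rw [← hG.fderiv_apply_apply hx, ← hG.fderiv_apply_apply hx]
  have : (fun y => G y u v) =ᶠ[𝓝 x] fun y => G y v u := by
    filter_upwards [hG.mem_nhds hx] with y hy using hG.symm y hy u v
  rw [this.fderiv_eq]

lemma ext (hG : IsMetricOn G Ω) {x : E} (hx : x ∈ Ω) {u v : E} (h : ∀ w, G x u w = G x v w) :
    u = v := by
  refine sub_eq_zero.1 (hG.nondegenerate x hx _ fun w => ?_)
  simp [h w]

lemma christoffel_symm (hG : IsMetricOn G Ω) {x : E} (hx : x ∈ Ω) (u v : E) :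
    christoffel G x u v = christoffel G x v u := by
  have : ((fderiv ℝ G x).flip u).flip v = ((fderiv ℝ G x).flip v).flip u := by
    ext w; simpa using hG.fderiv_symm hx w u v
  rw [christoffel, christoffel, this, add_comm (fderiv ℝ G x u v)]

variable [FiniteDimensional ℝ E]

lemma isInvertible (hG : IsMetricOn G Ω) {x : E} (hx : x ∈ Ω) : (G x).IsInvertible := by
  have hinj : Function.Injective (G x).toLinearMap := by
    refine (injective_iff_map_eq_zero _).2 fun u hu => hG.nondegenerate x hx u fun v => ?_
    change G x u = 0 at hu
    simp [hu]
  have hfr : Module.finrank ℝ E = Module.finrank ℝ (E →L[ℝ] ℝ) := by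
    rw [← (LinearMap.toContinuousLinearMap (𝕜 := ℝ) (E := E) (F' := ℝ)).finrank_eq]
    exact (Subspace.dual_finrank_eq (K := ℝ) (V := E)).symm
  refine ⟨(LinearMap.linearEquivOfInjective _ hinj hfr).toContinuousLinearEquiv, ?_⟩
  ext; rfl

lemma christoffel_spec (hG : IsMetricOn G Ω) {x : E} (hx : x ∈ Ω) (u v w : E) :
    G x (christoffel G x u v) w =
      1 / 2 * (fderiv ℝ G x u v w + fderiv ℝ G x v u w - fderiv ℝ G x w u v) := by
  rw [christoffel, (hG.isInvertible hx).self_apply_inverse]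
  simp

/-- Compatibility of the Levi-Civita connection with the metric. -/
lemma fderiv_eq_christoffel (hG : IsMetricOn G Ω) {x : E} (hx : x ∈ Ω) (a u v : E) :
    fderiv ℝ G x a u v = G x (christoffel G x a u) v + G x u (christoffel G x a v) := by
  rw [hG.symm x hx u, hG.christoffel_spec hx, hG.christoffel_spec hx, hG.fderiv_symm hx a v u,
    hG.fderiv_symm hx v, hG.fderiv_symm hx u]
  ring

lemma christoffel_eq (hG : IsMetricOn G Ω) {x : E} (hx : x ∈ Ω) {u v c : E}
    (h : ∀ w, G x c w =
      1 / 2 * (fderiv ℝ G x u v w + fderiv ℝ G x v u w - fderiv ℝ G x w u v)) :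
    christoffel G x u v = c :=
  hG.ext hx fun w => by rw [h, hG.christoffel_spec hx]

lemma differentiableAt_christoffelMap (hG : IsMetricOn G Ω) {x : E} (hx : x ∈ Ω) (u : E) :
    DifferentiableAt ℝ (fun y => christoffelMap G y u) x := by
  have h1 : DifferentiableAt ℝ (fun y => (G y).inverse) x := by
    obtain ⟨e, he⟩ := hG.isInvertible hx
    have := (contDiffAt_map_inverse (n := 2) (𝕜 := ℝ) e).differentiableAt (by norm_num)
    rw [he] at this
    exact this.comp x (hG.differentiableAt hx)
  have h2 := hG.differentiableAt_fderiv hx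
  have h3 : DifferentiableAt ℝ (fun y => (fderiv ℝ G y).flip) x :=
    (ContinuousLinearMap.flipₗᵢ ℝ E E (E →L[ℝ] ℝ)).differentiableAt.comp x h2
  have h4 : DifferentiableAt ℝ (fun y => (fderiv ℝ G y).flip u) x :=
    h3.clm_apply (differentiableAt_const u)
  have h5 : DifferentiableAt ℝ (fun y => ((fderiv ℝ G y).flip u).flip) x :=
    (ContinuousLinearMap.flipₗᵢ ℝ E E ℝ).differentiableAt.comp x h4
  exact h1.clm_comp ((((h2.clm_apply (differentiableAt_const u)).fun_add h4).fun_sub h5).fun_const_smul _)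

lemma differentiableAt_christoffel (hG : IsMetricOn G Ω) {x : E} (hx : x ∈ Ω) (u v : E) :
    DifferentiableAt ℝ (fun y => christoffel G y u v) x :=
  (hG.differentiableAt_christoffelMap hx u).clm_apply (differentiableAt_const v)

/-- The Ricci identity for a field `Z` with `∇_v Z = φ v`. -/
lemma riemann_concircular (hG : IsMetricOn G Ω) {Z : E → E} {φ : E → ℝ}
    (hZ : DifferentiableOn ℝ Z Ω) (hφ : DifferentiableOn ℝ φ Ω)
    (hcov : ∀ x ∈ Ω, ∀ v, covDeriv G Z x v = φ x • v) {x : E} (hx : x ∈ Ω) (u v : E) :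
    riemann G x u v (Z x) = fderiv ℝ φ x v • u - fderiv ℝ φ x u • v := by
  have hZd : ∀ y ∈ Ω, DifferentiableAt ℝ Z y := fun y hy => (hZ y hy).differentiableAt
    (hG.mem_nhds hy)
  have hφx : DifferentiableAt ℝ φ x := (hφ x hx).differentiableAt (hG.mem_nhds hx)
  have hDZ : ∀ y ∈ Ω, ∀ a, fderiv ℝ Z y a = φ y • a - christoffelMap G y a (Z y) := by
    intro y hy a
    rw [← hcov y hy a, covDeriv, christoffelMap_apply]; abel
  have happly : ∀ a b, fderiv ℝ (fun y => fderiv ℝ Z y a) x b =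
      fderiv ℝ φ x b • a - (fderiv ℝ (fun y => christoffel G y a (Z x)) x b
        + christoffel G x a (fderiv ℝ Z x b)) := by
    intro a b
    have he : (fun y => fderiv ℝ Z y a) =ᶠ[𝓝 x]
        fun y => φ y • a - christoffelMap G y a (Z y) := by
      filter_upwards [hG.mem_nhds hx] with y hy using hDZ y hy a
    rw [he.fderiv_eq]
    have h1 := hφx.hasFDerivAt.smul_const a
    have hΓ := (hG.differentiableAt_christoffelMap hx a).hasFDerivAt
    have h2 := hΓ.clm_apply (hZd x hx).hasFDerivAt
    have h3 := hΓ.clm_apply (hasFDerivAt_const (Z x) x)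
    have h4 : fderiv ℝ (fun y => christoffel G y a (Z x)) x = _ := h3.fderiv
    rw [(h1.fun_sub h2).fderiv, h4]
    simp [christoffelMap_apply, add_comm]
  have hdd : DifferentiableAt ℝ (fderiv ℝ Z) x := by
    refine differentiableAt_clm_of_apply fun a => ?_
    have he : (fun y => fderiv ℝ Z y a) =ᶠ[𝓝 x]
        fun y => φ y • a - christoffelMap G y a (Z y) := by
      filter_upwards [hG.mem_nhds hx] with y hy using hDZ y hy a
    refine he.differentiableAt_iff.2 ?_
    exact (hφx.smul_const a).sub
      ((hG.differentiableAt_christoffelMap hx a).clm_apply (hZd x hx))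
  have hsymm : fderiv ℝ (fun y => fderiv ℝ Z y u) x v = fderiv ℝ (fun y => fderiv ℝ Z y v) x u := by
    have hev : ∀ a b, fderiv ℝ (fun y => fderiv ℝ Z y a) x b = fderiv ℝ (fderiv ℝ Z) x b a := by
      intro a b
      rw [(hdd.hasFDerivAt.clm_apply (hasFDerivAt_const a x)).fderiv]; simp
    rw [hev, hev]
    exact second_derivative_symmetric_of_eventually
      (by filter_upwards [hG.mem_nhds hx] with y hy using (hZd y hy).hasFDerivAt)
      hdd.hasFDerivAt v u
  rw [happly, happly, hDZ x hx, hDZ x hx, ← christoffelMap_apply G x u, ← christoffelMap_apply G x v,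
    map_sub, map_sub, map_smul, map_smul] at hsymm
  simp only [christoffelMap_apply, hG.christoffel_symm hx v u] at hsymm
  rw [riemann_eq_christoffel]
  have key := sub_eq_zero.2 hsymm
  rw [← sub_eq_zero, ← neg_eq_zero.2 key]
  abel

end IsMetricOn

end Calculus

section Rigidity

variable {E : Type*} [NormedAddCommGroup E] [NormedSpace ℝ E] [FiniteDimensional ℝ E]
  {G : E → E →L[ℝ] E →L[ℝ] ℝ} {Ω : Set E}

/-- If the curvature is `k (g(X, ·) Y - g(Y, ·) X)`, the Hessian of `F` is `-k F g`, and `Z` is a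
concircular field with `Z F = F > 0`, then `k = 0`. -/
lemma IsMetricOn.curvature_eq_zero (hG : IsMetricOn G Ω) (h2 : 2 ≤ Module.finrank ℝ E)
    {F φ k : E → ℝ} {Z : E → E} (hF : ContDiffOn ℝ 2 F Ω) (hF0 : ∀ x ∈ Ω, F x ≠ 0)
    (hZ : DifferentiableOn ℝ Z Ω) (hφ : DifferentiableOn ℝ φ Ω)
    (hcov : ∀ x ∈ Ω, ∀ v, covDeriv G Z x v = φ x • v)
    (hZF : ∀ x ∈ Ω, fderiv ℝ F x (Z x) = F x)
    (hHess : ∀ x ∈ Ω, ∀ u v, fderiv ℝ (fderiv ℝ F) x u v - fderiv ℝ F x (christoffel G x u v)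
      = -(k x * F x * G x u v))
    (hR : ∀ x ∈ Ω, ∀ u v w, riemann G x u v w = k x • (G x u w • v - G x v w • u))
    {x : E} (hx : x ∈ Ω) : k x = 0 := by
  have hZd : ∀ y ∈ Ω, DifferentiableAt ℝ Z y := fun y hy => (hZ y hy).differentiableAt
    (hG.mem_nhds hy)
  have hφd : ∀ y ∈ Ω, DifferentiableAt ℝ φ y := fun y hy => (hφ y hy).differentiableAt
    (hG.mem_nhds hy)
  have hF1 : ∀ y ∈ Ω, DifferentiableAt ℝ F y := fun y hy =>
    (hF.contDiffAt (hG.mem_nhds hy)).differentiableAt (by norm_num)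
  have hF2 : ∀ y ∈ Ω, DifferentiableAt ℝ (fderiv ℝ F) y := fun y hy =>
    ((hF.contDiffAt (hG.mem_nhds hy)).fderiv_right (m := 1) (by norm_num)).differentiableAt
      (by norm_num)
  have hDZ : ∀ y ∈ Ω, ∀ a, fderiv ℝ Z y a = φ y • a - christoffel G y a (Z y) := by
    intro y hy a
    rw [← hcov y hy a, covDeriv]; abel
  have hdF : ∀ y ∈ Ω, ∀ u, (1 - φ y) * fderiv ℝ F y u = -(k y * F y * G y u (Z y)) := by
    intro y hy u
    have he : F =ᶠ[𝓝 y] fun z => fderiv ℝ F z (Z z) := by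
      filter_upwards [hG.mem_nhds hy] with z hz using (hZF z hz).symm
    have h := he.fderiv_eq (𝕜 := ℝ)
    rw [((hF2 y hy).hasFDerivAt.clm_apply (hZd y hy).hasFDerivAt).fderiv] at h
    have h' := congrArg (fun l => l u) h
    simp [hDZ y hy] at h'
    linarith [hHess y hy u (Z y)]
  have hφs : ∀ y ∈ Ω, 1 - φ y = -(k y * G y (Z y) (Z y)) := by
    intro y hy
    have h := hdF y hy (Z y)
    rw [hZF y hy] at h
    exact mul_right_cancel₀ (hF0 y hy) (by linarith)
  by_contra hk
  have hs0 : G x (Z x) (Z x) ≠ 0 := by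
    intro hs
    have h1 := hφs x hx
    have hZ0 : Z x = 0 := by
      refine hG.nondegenerate x hx _ fun u => ?_
      have h := hdF x hx u
      rw [h1, hs] at h
      rw [hG.symm x hx]
      have h3 : k x * F x * G x u (Z x) = 0 := by linarith
      simpa [hk, hF0 x hx] using h3
    have := hZF x hx
    rw [hZ0, map_zero] at this
    exact hF0 x hx this.symm
  have hscont : DifferentiableOn ℝ (fun y => G y (Z y) (Z y)) Ω := fun y hy =>
    (((hG.differentiableAt hy).clm_apply (hZd y hy)).clm_apply
      (hZd y hy)).differentiableWithinAt
  -- The locus where neither `1 - φ` nor `g(Z, Z)` vanishes.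
  have hgood : ∀ᶠ y in 𝓝 x, y ∈ Ω ∧ 1 - φ y ≠ 0 := by
    have h1 : 1 - φ x ≠ 0 := by rw [hφs x hx]; simp [hk, hs0]
    have hc : ContinuousAt (fun y => 1 - φ y) x := (hφd x hx).continuousAt.const_sub 1
    exact Filter.Eventually.and (hG.mem_nhds hx) (hc.eventually_ne h1)
  have hgrad : ∀ y ∈ Ω, 1 - φ y ≠ 0 → ∀ u,
      G y (Z y) (Z y) * fderiv ℝ F y u = F y * G y u (Z y) := by
    intro y hy hne u
    refine mul_left_cancel₀ hne ?_
    linear_combination G y (Z y) (Z y) * hdF y hy u - F y * G y u (Z y) * hφs y hy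
  have hhalf : ∀ y, (∀ᶠ z in 𝓝 y, z ∈ Ω ∧ 1 - φ z ≠ 0) → φ y = 1 / 2 := by
    intro y hev
    obtain ⟨hy, hne⟩ := hev.self_of_nhds
    have hs : G y (Z y) (Z y) ≠ 0 := by
      intro hs; rw [hφs y hy, hs] at hne; simp at hne
    obtain ⟨Y, hY0, hY⟩ := exists_ne_zero_apply_eq_zero h2 (G y (Z y))
    have hYZ : G y Y (Z y) = 0 := by rw [hG.symm y hy, hY]
    have hFY : fderiv ℝ F y Y = 0 := by
      have := hgrad y hy hne Y
      rw [hYZ, mul_zero] at this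
      exact (mul_eq_zero.1 this).resolve_left hs
    by_contra hφy
    refine hY0 (hG.nondegenerate y hy _ fun X => ?_)
    have he : (fun z => G z (Z z) (Z z) * fderiv ℝ F z X) =ᶠ[𝓝 y]
        fun z => F z * G z X (Z z) := by
      filter_upwards [hev] with z hz using hgrad z hz.1 hz.2 X
    have hGy := (hG.differentiableAt hy).hasFDerivAt
    have hZy := (hZd y hy).hasFDerivAt
    have hl := ((hGy.clm_apply hZy).clm_apply hZy).mul
      ((hF2 y hy).hasFDerivAt.clm_apply (hasFDerivAt_const X y))
    have hr := (hF1 y hy).hasFDerivAt.mul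
      ((hGy.clm_apply (hasFDerivAt_const X y)).clm_apply hZy)
    have h := congrArg (fun l => l Y) (hl.unique (hr.congr_of_eventuallyEq he))
    simp [hDZ y hy, hG.fderiv_eq_christoffel hy, hFY] at h
    have h3 := hHess y hy Y X
    have h4 := hgrad y hy hne (christoffel G y Y X)
    have h5 := hφs y hy
    rw [hG.symm y hy (Z y) Y, hYZ, hG.symm y hy (Z y) (christoffel G y Y (Z y))] at h
    have h6 := hG.symm y hy X Y
    rw [h6] at h
    have h7 : F y * (1 - 2 * φ y) * G y Y X = 0 := by
      linear_combination h - G y (Z y) (Z y) * h3 - h4 + F y * G y Y X * h5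
    rcases mul_eq_zero.1 h7 with h8 | h8
    · rcases mul_eq_zero.1 h8 with h9 | h9
      · exact absurd h9 (hF0 y hy)
      · exact absurd (by linarith) hφy
    · exact h8
  have hdφ : fderiv ℝ φ x = 0 := by
    have he : φ =ᶠ[𝓝 x] fun _ => (1 / 2 : ℝ) := by
      filter_upwards [hgood.eventually_nhds] with y hy using hhalf y hy
    rw [he.fderiv_eq]; simp
  obtain ⟨Y, hY0, hY⟩ := exists_ne_zero_apply_eq_zero h2 (G x (Z x))
  have h := hG.riemann_concircular hZ hφ hcov hx (Z x) Y
  rw [hR x hx, hG.symm x hx Y, hY, hdφ] at h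
  simp [hk, hs0, hY0] at h

end Rigidity

section Warped

variable {E₁ E₂ : Type*} [NormedAddCommGroup E₁] [NormedSpace ℝ E₁]
  [NormedAddCommGroup E₂] [NormedSpace ℝ E₂]

/-- `G` is the warped product of `G₁` and `G₂` with warping function `F` on `Ω₁ × Ω₂`. -/
structure IsWarpedOn (G : E₁ × E₂ → E₁ × E₂ →L[ℝ] E₁ × E₂ →L[ℝ] ℝ)
    (G₁ : E₁ → E₁ →L[ℝ] E₁ →L[ℝ] ℝ) (G₂ : E₂ → E₂ →L[ℝ] E₂ →L[ℝ] ℝ) (F : E₁ → ℝ)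
    (Ω₁ : Set E₁) (Ω₂ : Set E₂) : Prop where
  left : IsMetricOn G₁ Ω₁
  right : IsMetricOn G₂ Ω₂
  contDiffOn : ContDiffOn ℝ 2 F Ω₁
  ne_zero : ∀ x ∈ Ω₁, F x ≠ 0
  apply : ∀ x ∈ Ω₁ ×ˢ Ω₂, ∀ u v,
    G x u v = G₁ x.1 u.1 v.1 + F x.1 ^ 2 * G₂ x.2 u.2 v.2

lemma fderiv_comp_fst {W : Type*} [NormedAddCommGroup W] [NormedSpace ℝ W] {h : E₁ → W}
    {x : E₁ × E₂} (hh : DifferentiableAt ℝ h x.1) (a : E₁ × E₂) :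
    fderiv ℝ (fun y : E₁ × E₂ => h y.1) x a = fderiv ℝ h x.1 a.1 := by
  have := HasFDerivAt.comp x hh.hasFDerivAt (hasFDerivAt_fst (𝕜 := ℝ) (p := x))
  have h2 : fderiv ℝ (fun y : E₁ × E₂ => h y.1) x = _ := this.fderiv
  rw [h2]; rfl

namespace IsWarpedOn

variable [FiniteDimensional ℝ E₁] [FiniteDimensional ℝ E₂]
  {G : E₁ × E₂ → E₁ × E₂ →L[ℝ] E₁ × E₂ →L[ℝ] ℝ}
  {G₁ : E₁ → E₁ →L[ℝ] E₁ →L[ℝ] ℝ} {G₂ : E₂ → E₂ →L[ℝ] E₂ →L[ℝ] ℝ} {F : E₁ → ℝ}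
  {Ω₁ : Set E₁} {Ω₂ : Set E₂}

lemma isMetricOn (h : IsWarpedOn G G₁ G₂ F Ω₁ Ω₂) : IsMetricOn G (Ω₁ ×ˢ Ω₂) where
  isOpen := h.left.isOpen.prod h.right.isOpen
  contDiffOn := by
    rw [contDiffOn_clm_apply]
    intro u
    rw [contDiffOn_clm_apply]
    intro v
    refine ContDiffOn.congr ?_ fun x hx => h.apply x hx u v
    have h1 : ContDiffOn ℝ 2 (fun x : E₁ × E₂ => G₁ x.1) (Ω₁ ×ˢ Ω₂) :=
      h.left.contDiffOn.comp contDiffOn_fst fun x hx => hx.1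
    have h2 : ContDiffOn ℝ 2 (fun x : E₁ × E₂ => G₂ x.2) (Ω₁ ×ˢ Ω₂) :=
      h.right.contDiffOn.comp contDiffOn_snd fun x hx => hx.2
    have h3 : ContDiffOn ℝ 2 (fun x : E₁ × E₂ => F x.1) (Ω₁ ×ˢ Ω₂) :=
      h.contDiffOn.comp contDiffOn_fst fun x hx => hx.1
    exact ((h1.clm_apply contDiffOn_const).clm_apply contDiffOn_const).add
      ((h3.pow 2).mul ((h2.clm_apply contDiffOn_const).clm_apply contDiffOn_const))
  symm x hx u v := by
    rw [h.apply x hx, h.apply x hx, h.left.symm _ hx.1, h.right.symm _ hx.2]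
  nondegenerate x hx u hu := by
    have h1 : u.1 = 0 := h.left.nondegenerate _ hx.1 _ fun v => by
      have := hu (v, 0)
      rw [h.apply x hx] at this
      simpa using this
    have h2 : u.2 = 0 := h.right.nondegenerate _ hx.2 _ fun v => by
      have := hu (0, v)
      rw [h.apply x hx] at this
      simpa [h.ne_zero _ hx.1] using this
    exact Prod.ext h1 h2

lemma fderiv_apply (h : IsWarpedOn G G₁ G₂ F Ω₁ Ω₂) {x : E₁ × E₂} (hx : x ∈ Ω₁ ×ˢ Ω₂)
    (a u v : E₁ × E₂) :
    fderiv ℝ G x a u v = fderiv ℝ G₁ x.1 a.1 u.1 v.1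
      + (2 * F x.1 * fderiv ℝ F x.1 a.1 * G₂ x.2 u.2 v.2
        + F x.1 ^ 2 * fderiv ℝ G₂ x.2 a.2 u.2 v.2) := by
  rw [← h.isMetricOn.fderiv_apply_apply hx, ← h.left.fderiv_apply_apply hx.1,
    ← h.right.fderiv_apply_apply hx.2]
  have he : (fun y => G y u v) =ᶠ[𝓝 x]
      fun y => G₁ y.1 u.1 v.1 + F y.1 ^ 2 * G₂ y.2 u.2 v.2 := by
    filter_upwards [h.isMetricOn.mem_nhds hx] with y hy using h.apply y hy u v
  rw [he.fderiv_eq]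
  have d1 : DifferentiableAt ℝ (fun y => G₁ y u.1 v.1) x.1 :=
    ((h.left.differentiableAt hx.1).clm_apply (differentiableAt_const _)).clm_apply
      (differentiableAt_const _)
  have d2 : DifferentiableAt ℝ (fun y => G₂ y u.2 v.2) x.2 :=
    ((h.right.differentiableAt hx.2).clm_apply (differentiableAt_const _)).clm_apply
      (differentiableAt_const _)
  have d3 : DifferentiableAt ℝ F x.1 :=
    (h.contDiffOn.contDiffAt (h.left.mem_nhds hx.1)).differentiableAt (by norm_num)
  have e1 := HasFDerivAt.comp x d1.hasFDerivAt (hasFDerivAt_fst (𝕜 := ℝ) (p := x))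
  have e2 := HasFDerivAt.comp x d2.hasFDerivAt (hasFDerivAt_snd (𝕜 := ℝ) (p := x))
  have e3 := HasFDerivAt.comp x d3.hasFDerivAt (hasFDerivAt_fst (𝕜 := ℝ) (p := x))
  have e4 : fderiv ℝ (fun y : E₁ × E₂ => G₁ y.1 u.1 v.1 + F y.1 ^ 2 * G₂ y.2 u.2 v.2) x = _ :=
    (e1.add ((e3.pow 2).mul e2)).fderiv
  rw [e4]
  simp
  ring

lemma christoffel_inl_inl (h : IsWarpedOn G G₁ G₂ F Ω₁ Ω₂) {x : E₁ × E₂}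
    (hx : x ∈ Ω₁ ×ˢ Ω₂) (u v : E₁) :
    christoffel G x (u, 0) (v, 0) = (christoffel G₁ x.1 u v, 0) := by
  refine h.isMetricOn.christoffel_eq hx fun w => ?_
  rw [h.apply x hx]
  simp only [h.fderiv_apply hx, h.left.christoffel_spec hx.1]
  simp

lemma christoffel_inl_inr (h : IsWarpedOn G G₁ G₂ F Ω₁ Ω₂) {x : E₁ × E₂}
    (hx : x ∈ Ω₁ ×ˢ Ω₂) (u : E₁) (v : E₂) :
    christoffel G x (u, 0) (0, v) = (0, (fderiv ℝ F x.1 u / F x.1) • v) := by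
  refine h.isMetricOn.christoffel_eq hx fun w => ?_
  rw [h.apply x hx]
  simp only [h.fderiv_apply hx]
  have := h.ne_zero _ hx.1
  simp
  field_simp

lemma christoffel_inr_inl (h : IsWarpedOn G G₁ G₂ F Ω₁ Ω₂) {x : E₁ × E₂}
    (hx : x ∈ Ω₁ ×ˢ Ω₂) (u : E₁) (v : E₂) :
    christoffel G x (0, v) (u, 0) = (0, (fderiv ℝ F x.1 u / F x.1) • v) := by
  rw [h.isMetricOn.christoffel_symm hx, h.christoffel_inl_inr hx]

lemma riemann_inl_inl_inl (h : IsWarpedOn G G₁ G₂ F Ω₁ Ω₂) {x : E₁ × E₂}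
    (hx : x ∈ Ω₁ ×ˢ Ω₂) (u v w : E₁) :
    riemann G x (u, 0) (v, 0) (w, 0) = (riemann G₁ x.1 u v w, 0) := by
  have hd : ∀ a b : E₁, fderiv ℝ (fun y => christoffel G y (a, 0) (w, 0)) x (b, 0) =
      (fderiv ℝ (fun y => christoffel G₁ y a w) x.1 b, 0) := by
    intro a b
    have he : (fun y => christoffel G y (a, 0) (w, 0)) =ᶠ[𝓝 x]
        fun y => ContinuousLinearMap.inl ℝ E₁ E₂ (christoffel G₁ y.1 a w) := by
      filter_upwards [h.isMetricOn.mem_nhds hx] with y hy using h.christoffel_inl_inl hy a w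
    rw [he.fderiv_eq]
    have hc := h.left.differentiableAt_christoffel hx.1 a w
    rw [fderiv_comp_fst (h := fun z => ContinuousLinearMap.inl ℝ E₁ E₂ (christoffel G₁ z a w))
      ((ContinuousLinearMap.differentiableAt _).comp x.1 hc)]
    have h5 : fderiv ℝ (fun z => ContinuousLinearMap.inl ℝ E₁ E₂ (christoffel G₁ z a w)) x.1 = _ :=
      ((ContinuousLinearMap.inl ℝ E₁ E₂).hasFDerivAt.comp x.1 hc.hasFDerivAt).fderiv
    rw [h5]
    simp
  rw [riemann_eq_christoffel, riemann_eq_christoffel, hd, hd]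
  simp [h.christoffel_inl_inl hx]

lemma riemann_inl_inr_inl (h : IsWarpedOn G G₁ G₂ F Ω₁ Ω₂) {x : E₁ × E₂}
    (hx : x ∈ Ω₁ ×ˢ Ω₂) (u w : E₁) (v : E₂) :
    riemann G x (u, 0) (0, v) (w, 0) =
      (0, ((fderiv ℝ F x.1 (christoffel G₁ x.1 u w) - fderiv ℝ (fderiv ℝ F) x.1 u w) / F x.1)
        • v) := by
  have hFx := h.ne_zero _ hx.1
  have hF := h.contDiffOn.contDiffAt (h.left.mem_nhds hx.1)
  have hF1 : DifferentiableAt ℝ F x.1 := hF.differentiableAt (by norm_num)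
  have hF2 : DifferentiableAt ℝ (fderiv ℝ F) x.1 :=
    (hF.fderiv_right (m := 1) (by norm_num)).differentiableAt (by norm_num)
  have hd1 : fderiv ℝ (fun y => christoffel G y (u, 0) (w, 0)) x (0, v) = 0 := by
    have he : (fun y => christoffel G y (u, 0) (w, 0)) =ᶠ[𝓝 x]
        fun y => ContinuousLinearMap.inl ℝ E₁ E₂ (christoffel G₁ y.1 u w) := by
      filter_upwards [h.isMetricOn.mem_nhds hx] with y hy using h.christoffel_inl_inl hy u w
    rw [he.fderiv_eq,
      fderiv_comp_fst (h := fun z => ContinuousLinearMap.inl ℝ E₁ E₂ (christoffel G₁ z u w))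
      ((ContinuousLinearMap.differentiableAt _).comp x.1
        (h.left.differentiableAt_christoffel hx.1 u w))]
    simp
  have hd2 : fderiv ℝ (fun y => christoffel G y (0, v) (w, 0)) x (u, 0) =
      (0, ((fderiv ℝ (fderiv ℝ F) x.1 u w * F x.1 - fderiv ℝ F x.1 w * fderiv ℝ F x.1 u)
        / F x.1 ^ 2) • v) := by
    let L : ℝ →L[ℝ] E₁ × E₂ := (1 : ℝ →L[ℝ] ℝ).smulRight ((0, v) : E₁ × E₂)
    have he : (fun y => christoffel G y (0, v) (w, 0)) =ᶠ[𝓝 x]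
        fun y => L (fderiv ℝ F y.1 w * (F y.1)⁻¹) := by
      filter_upwards [h.isMetricOn.mem_nhds hx] with y hy
      rw [h.christoffel_inr_inl hy]
      simp [L, div_eq_mul_inv]
    have hq := (hF2.hasFDerivAt.clm_apply (hasFDerivAt_const w x.1)).fun_mul
      ((hasDerivAt_inv hFx).comp_hasFDerivAt x.1 hF1.hasFDerivAt)
    have hL := L.hasFDerivAt.comp x.1 hq
    rw [he.fderiv_eq, fderiv_comp_fst (h := fun z => L (fderiv ℝ F z w * (F z)⁻¹))
      hL.differentiableAt]
    have h5 : fderiv ℝ (fun z => L (fderiv ℝ F z w * (F z)⁻¹)) x.1 = _ := hL.fderiv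
    rw [h5]
    simp [L]
    simp only [smul_smul, ← neg_smul, ← add_smul]
    congr 1
    field_simp
    ring
  rw [riemann_eq_christoffel, hd1, hd2, h.christoffel_inl_inl hx, h.christoffel_inr_inl hx,
    h.christoffel_inr_inl hx, h.christoffel_inl_inr hx]
  simp only [zero_add, Prod.mk_add_mk, Prod.mk_sub_mk, sub_zero, add_zero, smul_smul, ← add_smul,
    ← sub_smul]
  congr 2
  field_simp
  ring

end IsWarpedOn

end Warped

section Charts

variable {E : Type*} [NormedAddCommGroup E] [NormedSpace ℝ E]
  {H : Type*} [TopologicalSpace H] {I : ModelWithCorners ℝ E H} [I.Boundaryless]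
  {M : Type*} [TopologicalSpace M] [ChartedSpace H M] [IsManifold I ∞ M]
  {e : OpenPartialHomeomorph M H}

lemma contMDiffOn_extend_symm_target (he : e ∈ atlas H M) :
    ContMDiffOn 𝓘(ℝ, E) I ∞ (e.extend I).symm (e.extend I).target := by
  have := contMDiffOn_extend_symm (n := ∞) (I := I)
    (IsManifold.subset_maximalAtlas (n := ∞) (I := I) he)
  rwa [I.image_eq, ← e.extend_target] at this

lemma contMDiffAt_extend_symm (he : e ∈ atlas H M) {x : E} (hx : x ∈ (e.extend I).target) :
    ContMDiffAt 𝓘(ℝ, E) I ∞ (e.extend I).symm x :=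
  (contMDiffOn_extend_symm_target he).contMDiffAt (e.isOpen_extend_target.mem_nhds hx)

lemma mdifferentiableAt_extend_symm (he : e ∈ atlas H M) {x : E}
    (hx : x ∈ (e.extend I).target) : MDifferentiableAt 𝓘(ℝ, E) I (e.extend I).symm x :=
  (contMDiffAt_extend_symm he hx).mdifferentiableAt (by simp)

lemma isInvertible_mfderiv_extend_symm (he : e ∈ atlas H M) {x : E}
    (hx : x ∈ (e.extend I).target) :
    (mfderiv 𝓘(ℝ, E) I (e.extend I).symm x).IsInvertible := by
  have hp : (e.extend I).symm x ∈ (e.extend I).source := (e.extend I).map_target hx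
  have hsrc : IsOpen (e.extend I).source := e.isOpen_extend_source
  have h1 := mdifferentiableAt_extend_symm he hx
  have h2 : MDifferentiableAt I 𝓘(ℝ, E) (e.extend I) ((e.extend I).symm x) := by
    have := (e.contMDiffOn_extend (n := ∞) (I := I)
      (IsManifold.subset_maximalAtlas (n := ∞) (I := I) he)).contMDiffAt
      (x := (e.extend I).symm x) (e.open_source.mem_nhds (by simpa using hp))
    exact this.mdifferentiableAt (by simp)
  have hxx := (e.extend I).right_inv hx
  refine ContinuousLinearMap.IsInvertible.of_inverse
    (g := mfderiv I 𝓘(ℝ, E) (e.extend I) ((e.extend I).symm x)) ?_ ?_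
  · have h1' : MDifferentiableAt 𝓘(ℝ, E) I (e.extend I).symm
        (e.extend I ((e.extend I).symm x)) := by rwa [hxx]
    have hc := mfderiv_comp ((e.extend I).symm x) h1' h2
    have hid : ((e.extend I).symm ∘ e.extend I) =ᶠ[𝓝 ((e.extend I).symm x)] id := by
      filter_upwards [hsrc.mem_nhds hp] with y hy using (e.extend I).left_inv hy
    rw [hid.mfderiv_eq, mfderiv_id] at hc
    rw [hxx] at hc
    exact hc.symm
  · have hc := mfderiv_comp x h2 h1
    have hid : (e.extend I ∘ (e.extend I).symm) =ᶠ[𝓝 x] id := by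
      filter_upwards [e.isOpen_extend_target.mem_nhds hx] with y hy
        using (e.extend I).right_inv hy
    rw [hid.mfderiv_eq, mfderiv_id] at hc
    exact hc.symm

lemma contMDiffOn_mfderiv_extend_symm (he : e ∈ atlas H M) (u : E) :
    ContMDiffOn 𝓘(ℝ, E) I.tangent ∞ (fun x : E => (⟨(e.extend I).symm x,
      mfderiv 𝓘(ℝ, E) I (e.extend I).symm x u⟩ : TangentBundle I M)) (e.extend I).target := by
  have hopen : IsOpen (e.extend I).target := e.isOpen_extend_target
  have h := (contMDiffOn_extend_symm_target (I := I) he).contMDiffOn_tangentMapWithin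
    (m := ∞) (by simp) hopen.uniqueMDiffOn
  have hu : ContMDiff 𝓘(ℝ, E) 𝓘(ℝ, E).tangent ∞
      (fun x : E => (⟨x, u⟩ : TangentBundle 𝓘(ℝ, E) E)) :=
    contMDiff_vectorSpace_iff_contDiff (V := fun _ => u).2 contDiff_const
  refine (h.comp hu.contMDiffOn fun x hx => hx).congr fun x hx => ?_
  have hd : mfderivWithin 𝓘(ℝ, E) I (e.extend I).symm (e.extend I).target x =
      mfderiv 𝓘(ℝ, E) I (e.extend I).symm x := mfderivWithin_of_isOpen hopen hx
  simp only [Function.comp_apply, tangentMapWithin, hd]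

lemma metricInChart_apply (g : Π p : M, TangentSpace I p →L[ℝ] TangentSpace I p →L[ℝ] ℝ)
    (e : OpenPartialHomeomorph M H) (x u v : E) :
    metricInChart I g e x u v = g ((e.extend I).symm x)
      (mfderiv 𝓘(ℝ, E) I (e.extend I).symm x u) (mfderiv 𝓘(ℝ, E) I (e.extend I).symm x v) := rfl

lemma IsPseudoRiemannianMetric.contDiffOn_metricInChart_apply
    {g : Π p : M, TangentSpace I p →L[ℝ] TangentSpace I p →L[ℝ] ℝ}
    (hg : IsPseudoRiemannianMetric I g) (he : e ∈ atlas H M) (u v : E) :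
    ContDiffOn ℝ ∞ (fun x => metricInChart I g e x u v) (e.extend I).target := by
  have hgc := hg.contMDiff.comp_contMDiffOn (contMDiffOn_extend_symm_target (I := I) he)
  have h := ContMDiffOn.clm_bundle_apply₂ (F₁ := E) (F₂ := E) (F₃ := ℝ)
    (E₁ := fun p : M => TangentSpace I p) (E₂ := fun p : M => TangentSpace I p)
    (E₃ := Bundle.Trivial M ℝ) (b := (e.extend I).symm)
    (ψ := fun x => g ((e.extend I).symm x))
    hgc (contMDiffOn_mfderiv_extend_symm he u) (contMDiffOn_mfderiv_extend_symm he v)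
  rw [← contMDiffOn_iff_contDiffOn]
  intro x hx
  exact (Bundle.contMDiffWithinAt_totalSpace.1 (h x hx)).2

lemma metricInChart_nondegenerate
    {g : Π p : M, TangentSpace I p →L[ℝ] TangentSpace I p →L[ℝ] ℝ}
    (hg : IsPseudoRiemannianMetric I g) (he : e ∈ atlas H M) {x : E}
    (hx : x ∈ (e.extend I).target) {u : E} (hu : ∀ v, metricInChart I g e x u v = 0) :
    u = 0 := by
  have hA := isInvertible_mfderiv_extend_symm (I := I) he hx
  have h0 := hg.nondegenerate _ (mfderiv 𝓘(ℝ, E) I (e.extend I).symm x u) fun w => by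
    have : g _ (mfderiv 𝓘(ℝ, E) I (e.extend I).symm x u) (mfderiv 𝓘(ℝ, E) I (e.extend I).symm x
        ((mfderiv 𝓘(ℝ, E) I (e.extend I).symm x).inverse w)) = 0 := hu _
    rwa [hA.self_apply_inverse] at this
  exact hA.injective (h0.trans (map_zero _).symm)

lemma IsPseudoRiemannianMetric.isMetricOn [FiniteDimensional ℝ E]
    {g : Π p : M, TangentSpace I p →L[ℝ] TangentSpace I p →L[ℝ] ℝ}
    (hg : IsPseudoRiemannianMetric I g) (he : e ∈ atlas H M) :
    IsMetricOn (metricInChart I g e) (e.extend I).target where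
  isOpen := e.isOpen_extend_target
  contDiffOn := contDiffOn_clm_apply.2 fun u => contDiffOn_clm_apply.2 fun v =>
    (hg.contDiffOn_metricInChart_apply he u v).of_le (by norm_cast)
  symm x _ u v := hg.symm _ (mfderiv 𝓘(ℝ, E) I (e.extend I).symm x u)
    (mfderiv 𝓘(ℝ, E) I (e.extend I).symm x v)
  nondegenerate x hx u hu := metricInChart_nondegenerate hg he hx hu

lemma mfderiv_fieldInChart (ζ : Π p : M, TangentSpace I p) (he : e ∈ atlas H M) {x : E}
    (hx : x ∈ (e.extend I).target) :
    mfderiv 𝓘(ℝ, E) I (e.extend I).symm x (fieldInChart (E := E) I ζ e x) = ζ ((e.extend I).symm x) :=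
  (isInvertible_mfderiv_extend_symm he hx).self_apply_inverse _

lemma differentiableOn_fieldInChart [CompleteSpace E] {ζ : Π p : M, TangentSpace I p}
    (hζ : ContMDiff I I.tangent ∞ (fun p => (⟨p, ζ p⟩ : TangentBundle I M)))
    (he : e ∈ atlas H M) :
    DifferentiableOn ℝ (fieldInChart I ζ e) (e.extend I).target := by
  intro x hx
  have : IsManifold I (1 + 1) M := IsManifold.of_le (n := ∞) (by norm_cast)
  have h := ContMDiffAt.mpullback_vectorField_preimage (m := 1) (n := ∞)
    (hζ.contMDiffAt.of_le (by norm_cast)) (contMDiffAt_extend_symm he hx)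
    (isInvertible_mfderiv_extend_symm he hx) (by norm_cast)
  have h' := contMDiffAt_vectorSpace_iff_contDiffAt.1 h
  exact (h'.differentiableAt (by simp)).differentiableWithinAt

lemma contDiffOn_comp_extend_symm {φ : M → ℝ} (hφ : ContMDiff I 𝓘(ℝ, ℝ) ∞ φ)
    (he : e ∈ atlas H M) :
    ContDiffOn ℝ ∞ (fun x => φ ((e.extend I).symm x)) (e.extend I).target :=
  contMDiffOn_iff_contDiffOn.1
    (hφ.comp_contMDiffOn (contMDiffOn_extend_symm_target he))

lemma fderiv_comp_extend_symm {f : M → ℝ} (hf : ContMDiff I 𝓘(ℝ, ℝ) ∞ f)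
    (he : e ∈ atlas H M) {x : E} (hx : x ∈ (e.extend I).target) (v : E) :
    fderiv ℝ (fun y => f ((e.extend I).symm y)) x v =
      mfderiv I 𝓘(ℝ, ℝ) f ((e.extend I).symm x) (mfderiv 𝓘(ℝ, E) I (e.extend I).symm x v) := by
  have h := mfderiv_comp x (hf.mdifferentiableAt (by simp) (x := (e.extend I).symm x))
    (mdifferentiableAt_extend_symm he hx)
  rw [mfderiv_eq_fderiv] at h
  exact congrArg (fun l : E →L[ℝ] ℝ => l v) h

end Charts

section Product

variable {E₁ : Type*} [NormedAddCommGroup E₁] [NormedSpace ℝ E₁]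
  {H₁ : Type*} [TopologicalSpace H₁] {I₁ : ModelWithCorners ℝ E₁ H₁} [I₁.Boundaryless]
  {M₁ : Type*} [TopologicalSpace M₁] [ChartedSpace H₁ M₁] [IsManifold I₁ ∞ M₁]
  {E₂ : Type*} [NormedAddCommGroup E₂] [NormedSpace ℝ E₂]
  {H₂ : Type*} [TopologicalSpace H₂] {I₂ : ModelWithCorners ℝ E₂ H₂} [I₂.Boundaryless]
  {M₂ : Type*} [TopologicalSpace M₂] [ChartedSpace H₂ M₂] [IsManifold I₂ ∞ M₂]
  {e₁ : OpenPartialHomeomorph M₁ H₁} {e₂ : OpenPartialHomeomorph M₂ H₂}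

lemma metricInChart_warpedMetric (g₁ : Π p : M₁, TangentSpace I₁ p →L[ℝ] TangentSpace I₁ p →L[ℝ] ℝ)
    (g₂ : Π q : M₂, TangentSpace I₂ q →L[ℝ] TangentSpace I₂ q →L[ℝ] ℝ) (f : M₁ → ℝ)
    (he₁ : e₁ ∈ atlas H₁ M₁) (he₂ : e₂ ∈ atlas H₂ M₂) {x : E₁ × E₂}
    (hx : x ∈ (e₁.extend I₁).target ×ˢ (e₂.extend I₂).target) (u v : E₁ × E₂) :
    metricInChart (I₁.prod I₂) (warpedMetric I₁ I₂ g₁ g₂ f) (e₁.prod e₂) x u v =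
      metricInChart I₁ g₁ e₁ x.1 u.1 v.1
        + f ((e₁.extend I₁).symm x.1) ^ 2 * metricInChart I₂ g₂ e₂ x.2 u.2 v.2 := by
  have hψ : (((e₁.prod e₂).extend (I₁.prod I₂)).symm : E₁ × E₂ → M₁ × M₂) =
      Prod.map (e₁.extend I₁).symm (e₂.extend I₂).symm := by
    rw [OpenPartialHomeomorph.extend_prod]; rfl
  have hd : mfderiv 𝓘(ℝ, E₁ × E₂) (I₁.prod I₂) ((e₁.prod e₂).extend (I₁.prod I₂)).symm x =
      (mfderiv 𝓘(ℝ, E₁) I₁ (e₁.extend I₁).symm x.1).prodMap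
        (mfderiv 𝓘(ℝ, E₂) I₂ (e₂.extend I₂).symm x.2) := by
    rw [hψ, modelWithCornersSelf_prod, ← chartedSpaceSelf_prod]
    exact mfderiv_prodMap (mdifferentiableAt_extend_symm he₁ hx.1)
      (mdifferentiableAt_extend_symm he₂ hx.2)
  rw [metricInChart_apply, hd, metricInChart_apply, metricInChart_apply]
  simp only [warpedMetric, mfderiv_fst, mfderiv_snd]
  rfl

end Product

section WarpedCurvature

variable {E₁ E₂ : Type*} [NormedAddCommGroup E₁] [NormedSpace ℝ E₁]
  [NormedAddCommGroup E₂] [NormedSpace ℝ E₂] [FiniteDimensional ℝ E₁] [FiniteDimensional ℝ E₂]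
  {G : E₁ × E₂ → E₁ × E₂ →L[ℝ] E₁ × E₂ →L[ℝ] ℝ}
  {G₁ : E₁ → E₁ →L[ℝ] E₁ →L[ℝ] ℝ} {G₂ : E₂ → E₂ →L[ℝ] E₂ →L[ℝ] ℝ} {F : E₁ → ℝ}
  {Ω₁ : Set E₁} {Ω₂ : Set E₂}

namespace IsWarpedOn

lemma hessian_eq [Nontrivial E₂] (h : IsWarpedOn G G₁ G₂ F Ω₁ Ω₂) {x : E₁ × E₂}
    (hx : x ∈ Ω₁ ×ˢ Ω₂) {κ : ℝ}
    (hκ : ∀ u v w, riemann G x u v w = κ • (G x u w • v - G x v w • u)) (u v : E₁) :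
    fderiv ℝ (fderiv ℝ F) x.1 u v - fderiv ℝ F x.1 (christoffel G₁ x.1 u v)
      = -(κ * F x.1 * G₁ x.1 u v) := by
  obtain ⟨U, hU⟩ := exists_ne (0 : E₂)
  have h1 := hκ (u, 0) (0, U) (v, 0)
  rw [h.riemann_inl_inr_inl hx, h.apply x hx, h.apply x hx] at h1
  have h2 := congrArg Prod.snd h1
  simp only [map_zero, zero_apply, mul_zero, add_zero, zero_smul, sub_zero,
    Prod.smul_snd, smul_smul] at h2
  have h3 := smul_left_injective ℝ hU h2
  rw [div_eq_iff (h.ne_zero _ hx.1)] at h3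
  linarith

lemma riemann_left_eq (h : IsWarpedOn G G₁ G₂ F Ω₁ Ω₂) {x : E₁ × E₂} (hx : x ∈ Ω₁ ×ˢ Ω₂) {κ : ℝ}
    (hκ : ∀ u v w, riemann G x u v w = κ • (G x u w • v - G x v w • u)) (u v w : E₁) :
    riemann G₁ x.1 u v w = κ • (G₁ x.1 u w • v - G₁ x.1 v w • u) := by
  have h1 := hκ (u, 0) (v, 0) (w, 0)
  rw [h.riemann_inl_inl_inl hx, h.apply x hx, h.apply x hx] at h1
  simpa using congrArg Prod.fst h1

/-- A product metric of constant curvature is flat. -/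
lemma curvature_eq_zero_of_const [Nontrivial E₁] [Nontrivial E₂]
    (h : IsWarpedOn G G₁ G₂ F Ω₁ Ω₂) {x : E₁ × E₂} (hx : x ∈ Ω₁ ×ˢ Ω₂) {κ c : ℝ}
    (hκ : ∀ u v w, riemann G x u v w = κ • (G x u w • v - G x v w • u))
    (hc : ∀ y, F y = c) : κ = 0 := by
  obtain ⟨u, hu⟩ := exists_ne (0 : E₁)
  by_contra hk
  refine hu (h.left.nondegenerate _ hx.1 _ fun v => ?_)
  have h1 := h.hessian_eq hx hκ u v
  have h2 : fderiv ℝ F = 0 := by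
    rw [show F = fun _ => c from funext hc]
    ext; simp
  simp [h2, hk, h.ne_zero _ hx.1] at h1
  exact h1

/-- A warped product of constant curvature whose base carries a concircular field `Z` with
`Z F = F` is flat. -/
lemma curvature_eq_zero_of_concircular (hdim : 2 ≤ Module.finrank ℝ E₁) [Nontrivial E₂]
    (h : IsWarpedOn G G₁ G₂ F Ω₁ Ω₂) {κ : E₁ × E₂ → ℝ}
    (hκ : ∀ x ∈ Ω₁ ×ˢ Ω₂, ∀ u v w, riemann G x u v w = κ x • (G x u w • v - G x v w • u))
    {Z : E₁ → E₁} {φ : E₁ → ℝ} (hZ : DifferentiableOn ℝ Z Ω₁) (hφ : DifferentiableOn ℝ φ Ω₁)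
    (hcov : ∀ x ∈ Ω₁, ∀ v, covDeriv G₁ Z x v = φ x • v)
    (hZF : ∀ x ∈ Ω₁, fderiv ℝ F x (Z x) = F x) {x : E₁ × E₂} (hx : x ∈ Ω₁ ×ˢ Ω₂) : κ x = 0 :=
  h.left.curvature_eq_zero (k := fun y => κ (y, x.2)) hdim h.contDiffOn h.ne_zero hZ hφ hcov hZF
    (fun y hy => h.hessian_eq (x := (y, x.2)) ⟨hy, hx.2⟩ (hκ _ ⟨hy, hx.2⟩))
    (fun y hy => h.riemann_left_eq (x := (y, x.2)) ⟨hy, hx.2⟩ (hκ _ ⟨hy, hx.2⟩)) hx.1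

end IsWarpedOn

end WarpedCurvature

end PseudoRiemann

theorem mainTheorem8 {n₁ n₂ : ℕ} (hn₁ : 2 ≤ n₁) (hn₂ : 2 ≤ n₂)
    {M₁ : Type*} [TopologicalSpace M₁] [T2Space M₁] [SecondCountableTopology M₁]
    [ChartedSpace (EuclideanSpace ℝ (Fin n₁)) M₁] [IsManifold (𝓡 n₁) ∞ M₁]
    {M₂ : Type*} [TopologicalSpace M₂] [T2Space M₂] [SecondCountableTopology M₂]
    [ChartedSpace (EuclideanSpace ℝ (Fin n₂)) M₂] [IsManifold (𝓡 n₂) ∞ M₂]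
    (g₁ : Π p : M₁, TangentSpace (𝓡 n₁) p →L[ℝ] TangentSpace (𝓡 n₁) p →L[ℝ] ℝ)
    (hg₁ : PseudoRiemann.IsPseudoRiemannianMetric (𝓡 n₁) g₁)
    (g₂ : Π q : M₂, TangentSpace (𝓡 n₂) q →L[ℝ] TangentSpace (𝓡 n₂) q →L[ℝ] ℝ)
    (hg₂ : PseudoRiemann.IsPseudoRiemannianMetric (𝓡 n₂) g₂)
    (f : M₁ → ℝ) (hf : ContMDiff (𝓡 n₁) 𝓘(ℝ, ℝ) ∞ f) (hf_pos : ∀ p, 0 < f p)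
    (hflat : PseudoRiemann.IsConcircularlyFlat ((𝓡 n₁).prod (𝓡 n₂))
      (PseudoRiemann.warpedMetric (𝓡 n₁) (𝓡 n₂) g₁ g₂ f))
    (ζ₁ : Π p : M₁, TangentSpace (𝓡 n₁) p)
    (hζ₁ : PseudoRiemann.IsConcircular (𝓡 n₁) g₁ ζ₁)
    (h : ((∃ ζ₂ : Π q : M₂, TangentSpace (𝓡 n₂) q,
            PseudoRiemann.IsConcircular (𝓡 n₂) g₂ ζ₂) ∧ ∃ c : ℝ, ∀ p, f p = c) ∨
      ∀ p, mfderiv (𝓡 n₁) 𝓘(ℝ, ℝ) f p (ζ₁ p) = f p) :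
    PseudoRiemann.IsFlat ((𝓡 n₁).prod (𝓡 n₂))
      (PseudoRiemann.warpedMetric (𝓡 n₁) (𝓡 n₂) g₁ g₂ f) := by
  intro e he x hx u v w
  obtain ⟨e₁, he₁, e₂, he₂, rfl⟩ := he
  have htarget : ((e₁.prod e₂).extend ((𝓡 n₁).prod (𝓡 n₂))).target =
      (e₁.extend (𝓡 n₁)).target ×ˢ (e₂.extend (𝓡 n₂)).target := by
    rw [OpenPartialHomeomorph.extend_prod]; rfl
  have hx' := hx
  rw [htarget] at hx'
  set G := PseudoRiemann.metricInChart ((𝓡 n₁).prod (𝓡 n₂)) (PseudoRiemann.warpedMetric (𝓡 n₁) (𝓡 n₂) g₁ g₂ f)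
    (e₁.prod e₂) with hG
  have hW : PseudoRiemann.IsWarpedOn G (PseudoRiemann.metricInChart (𝓡 n₁) g₁ e₁) (PseudoRiemann.metricInChart (𝓡 n₂) g₂ e₂)
      (fun y => f ((e₁.extend (𝓡 n₁)).symm y)) (e₁.extend (𝓡 n₁)).target
      (e₂.extend (𝓡 n₂)).target :=
    { left := hg₁.isMetricOn he₁
      right := hg₂.isMetricOn he₂
      contDiffOn := (PseudoRiemann.contDiffOn_comp_extend_symm hf he₁).of_le (by norm_cast)
      ne_zero := fun y _ => (hf_pos _).ne'
      apply := fun y hy u v => PseudoRiemann.metricInChart_warpedMetric g₁ g₂ f he₁ he₂ hy u v }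
  obtain ⟨κ, hκ⟩ : ∃ κ : EuclideanSpace ℝ (Fin n₁) × EuclideanSpace ℝ (Fin n₂) → ℝ,
      ∀ y ∈ (e₁.extend (𝓡 n₁)).target ×ˢ (e₂.extend (𝓡 n₂)).target, ∀ u v w,
        PseudoRiemann.riemann G y u v w = κ y • (G y u w • v - G y v w • u) :=
    ⟨_, fun y hy u v w => sub_eq_zero.1
      (hflat (e₁.prod e₂) ⟨e₁, he₁, e₂, he₂, rfl⟩ y (htarget ▸ hy) u v w)⟩
  have hdim : 2 ≤ Module.finrank ℝ (EuclideanSpace ℝ (Fin n₁)) := by simpa using hn₁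
  have : Nontrivial (EuclideanSpace ℝ (Fin n₁)) :=
    Module.nontrivial_of_finrank_pos (R := ℝ) (by omega)
  have : Nontrivial (EuclideanSpace ℝ (Fin n₂)) :=
    Module.nontrivial_of_finrank_pos (R := ℝ) (by simp; omega)
  have hκ0 : κ x = 0 := by
    rcases h with ⟨-, c, hc⟩ | hζf
    · exact hW.curvature_eq_zero_of_const hx' (hκ x hx') fun y => hc _
    · obtain ⟨hζs, φ, hφ, hcov⟩ := hζ₁
      refine hW.curvature_eq_zero_of_concircular hdim hκ
        (PseudoRiemann.differentiableOn_fieldInChart hζs he₁)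
        ((PseudoRiemann.contDiffOn_comp_extend_symm hφ he₁).differentiableOn (by simp))
        (hcov e₁ he₁) (fun y hy => ?_) hx'
      rw [PseudoRiemann.fderiv_comp_extend_symm hf he₁ hy, PseudoRiemann.mfderiv_fieldInChart ζ₁ he₁ hy, hζf]
  rw [hκ x hx', hκ0, zero_smul]
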